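/- Let $\mathbb{K}$ be a field of characteristic zero, $S=\mathbb{K}[x_1,\dots,x_l]$ with its standard grading, and let $\mathcal{A}$ be a central hyperplane arrangement in $\mathbb{K}^l$, that is, a finite set of linear hyperplanes $H=\ker\alpha_H$. Let $D(\mathcal{A})$ be the graded $S$-module of polynomial vector fields $\delta=\sum_i f_i\partial_{x_i}$ ($f_i\in S$) such that $\delta(\alpha_H)\in \alpha_H S$ for all $H\in\mathcal{A}$; here $\delta$ is homogeneous of degree $d$ if all $f_i$ are homogeneous of degree $d$. The arrangement $\mathcal{A}$ is called *free* if $D(\mathcal{A})$ has an $S$-basis consisting of $l$ homogeneous vector fields. It is called *plus-one generated* if, for some non-negative integers $d_1,\dots,d_l$ and $d$, $D(\mathcal{A})$ has a minimal graded free resolution of the form $$0\to S(-d-1)\xrightarrow{(\alpha,f_1,\dots,f_l)} S(-d)\oplus\bigoplus_{i=1}^l S(-d_i)\to D(\mathcal{A})\to 0,$$ where $\alpha$ is a nonzero linear form. Let $L(\mathcal{A})$ be the set of all intersections $\bigcap_{H\in\mathcal{B}}H$ with $\mathcal{B}\subseteq\mathcal{A}$ (with $\mathcal{B}=\emptyset$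 giving $\mathbb{K}^l$), and for $X\in L(\mathcal{A})$ let $\mathcal{A}_X=\{H\in\mathcal{A}\mid X\subseteq H\}$. If $\mathcal{A}$ is plus-one generated and $X\in L(\mathcal{A})$, then $\mathcal{A}_X$ is free or plus-one generated. -/

import Mathlib

namespace HypArr

/-- A central hyperplane arrangement in `K ^ l`: a finite set of linear hyperplanes,
that is, of maximal proper linear subspaces. -/
structure CentralArrangement (K : Type*) [Field K] (l : ℕ) where
  hyperplanes : Finset (Submodule K (Fin l → K))
  isHyperplane : ∀ H ∈ hyperplanes, IsCoatom H

/-- The lattice of intersection `L(A)`: all intersections of subsets of `A`; the empty subset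
gives the whole space. -/
def CentralArrangement.intersectionLattice {K : Type*} [Field K] {l : ℕ}
    (A : CentralArrangement K l) : Set (Submodule K (Fin l → K)) :=
  {X | ∃ B ⊆ A.hyperplanes, X = B.inf id}

open scoped Classical in
/-- The localization `A_X`: the hyperplanes of `A` that contain `X`. -/
noncomputable def CentralArrangement.localization {K : Type*} [Field K] {l : ℕ}
    (A : CentralArrangement K l) (X : Submodule K (Fin l → K)) : CentralArrangement K l where
  hyperplanes := A.hyperplanes.filter (fun H => X ≤ H)
  isHyperplane := fun H hH => A.isHyperplane H (Finset.mem_filter.mp hH).1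

/-- The polynomial vector fields on `K ^ l`, a module over `K[x_1, …, x_l]`. -/
abbrev VectorField (K : Type*) [Field K] (l : ℕ) : Type _ :=
  Derivation K (MvPolynomial (Fin l) K) (MvPolynomial (Fin l) K)

/-- The homogeneous linear polynomial `∑ i, φ (e_i) x_i` of a linear functional `φ` on `K ^ l`. -/
noncomputable def linearForm {K : Type*} [Field K] {l : ℕ}
    (φ : Module.Dual K (Fin l → K)) : MvPolynomial (Fin l) K :=
  ∑ i, MvPolynomial.C (φ (Pi.single i 1)) * MvPolynomial.X i

/-- `δ = ∑ i, f_i ∂/∂x_i` is homogeneous of polynomial degree `d`: every `f_i = δ x_i` is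
homogeneous of degree `d`. -/
def IsHomogeneousField {K : Type*} [Field K] {l : ℕ} (δ : VectorField K l) (d : ℕ) : Prop :=
  ∀ i, (δ (MvPolynomial.X i)).IsHomogeneous d

/-- The module `D(A)` of logarithmic vector fields: `δ α ∈ (α)` for every hyperplane of `A`, where
`α` is a defining linear form of the hyperplane. Two such forms differ by a nonzero scalar, so
asking this for all of them is the same as asking it for a chosen one. -/
def CentralArrangement.logDer {K : Type*} [Field K] {l : ℕ} (A : CentralArrangement K l) :
    Submodule (MvPolynomial (Fin l) K) (VectorField K l) where
  carrier := {δ | ∀ H ∈ A.hyperplanes, ∀ φ : Module.Dual K (Fin l → K),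
    LinearMap.ker φ = H → δ (linearForm φ) ∈ Ideal.span {linearForm φ}}
  zero_mem' := fun _ _ _ _ => by simp
  add_mem' := fun ha hb H hH φ hφ => by
    simpa using add_mem (ha H hH φ hφ) (hb H hH φ hφ)
  smul_mem' := fun c _ ha H hH φ hφ => by
    simpa using Ideal.mul_mem_left _ c (ha H hH φ hφ)

/-- `A` is free with exponents `(e_1, …, e_l)`: `D(A)` has a basis of `l` homogeneous vector
fields of polynomial degrees `e_1, …, e_l`. -/
def CentralArrangement.IsFreeWithExponents {K : Type*} [Field K] {l : ℕ}
    (A : CentralArrangement K l) (e : Fin l → ℕ) : Prop :=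
  ∃ b : Module.Basis (Fin l) (MvPolynomial (Fin l) K) A.logDer,
    ∀ i, IsHomogeneousField (b i : VectorField K l) (e i)

/-- `A` is free. -/
def CentralArrangement.IsFree {K : Type*} [Field K] {l : ℕ}
    (A : CentralArrangement K l) : Prop :=
  ∃ e : Fin l → ℕ, A.IsFreeWithExponents e

/-- `v` is a homogeneous element of degree `k` of the graded free module `⨁ i, S(-a_i)`: the
entry `v i` is homogeneous of degree `k - a_i`, and is zero if `k < a_i`. -/
def IsTwistedHomogeneous {K : Type*} [Field K] {l : ℕ} {ι : Type*}
    (a : ι → ℕ) (k : ℕ) (v : ι → MvPolynomial (Fin l) K) : Prop :=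
  ∀ i, ∀ m : Fin l →₀ ℕ, (v i).coeff m ≠ 0 → a i + m.degree = k

/-- `A` is plus-one generated with exponents `(d_1, …, d_l)` and level `d`: there is a minimal
graded free resolution
`0 → S(-d-1) → S(-d) ⊕ S(-d_1) ⊕ … ⊕ S(-d_l) → D(A) → 0`
whose first map is given by `(α, f_1, …, f_l)` with `α` a nonzero linear form.
The second map sends the standard basis to vector fields `g 0, g 1, …, g l`. Both maps preserve
degrees, and minimality says that the entries of the first map lie in the ideal
`(x_1, …, x_l)`. -/
def CentralArrangement.IsPlusOneGeneratedWith {K : Type*} [Field K] {l : ℕ}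
    (A : CentralArrangement K l) (exps : Fin l → ℕ) (d : ℕ) : Prop :=
  ∃ (α : MvPolynomial (Fin l) K) (f : Fin l → MvPolynomial (Fin l) K)
    (g : Fin (l + 1) → A.logDer),
    let shifts : Fin (l + 1) → ℕ := Fin.cons d exps
    let entries : Fin (l + 1) → MvPolynomial (Fin l) K := Fin.cons α f
    let syz : MvPolynomial (Fin l) K →ₗ[MvPolynomial (Fin l) K]
        (Fin (l + 1) → MvPolynomial (Fin l) K) :=
      LinearMap.toSpanSingleton _ _ entries
    let aug : (Fin (l + 1) → MvPolynomial (Fin l) K) →ₗ[MvPolynomial (Fin l) K] A.logDer :=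
      Fintype.linearCombination (MvPolynomial (Fin l) K) g
    α ≠ 0 ∧ α.IsHomogeneous 1 ∧
    IsTwistedHomogeneous shifts (d + 1) entries ∧
    (∀ j, IsHomogeneousField (g j : VectorField K l) (shifts j)) ∧
    Function.Injective syz ∧ Function.Exact syz aug ∧ Function.Surjective aug ∧
    (∀ j, entries j ∈ Ideal.span (Set.range (MvPolynomial.X : Fin l → MvPolynomial (Fin l) K)))

/-- `A` is plus-one generated. -/
def CentralArrangement.IsPlusOneGenerated {K : Type*} [Field K] {l : ℕ}
    (A : CentralArrangement K l) : Prop :=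
  ∃ (exps : Fin l → ℕ) (d : ℕ), A.IsPlusOneGeneratedWith exps d

end HypArr

/-! Write `S` for the polynomial ring and `𝔪` for the ideal of the variables. Choose a point `p` of
`X` lying on no hyperplane of `A` outside `A_X`. Near `p` the two arrangements agree, so translating
`p` to the origin turns generators of `D(A)` into elements of `D(A_X)` that generate it modulo `𝔪
D(A_X)`: the product of the forms not vanishing at `p` has become invertible there
(`exists_sub_sum_translate_mem`). Hence `D(A_X)`, a graded module of rank `l`, has a minimal
homogeneous generating family of at most `l + 1` elements.

If it has `l` elements, there are no relations and `A_X` is free. If it has `l + 1`, the relations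
form a saturated rank one submodule of `S ^ (l + 1)`, hence a cyclic one because `S` is factorial,
with a twisted homogeneous generator `r` without constant terms. It remains to find a linear form
among the entries of `r`. The translated relation of `A` is a relation on translated generators that
are again minimal, so in terms of `r` it is `q r` up to an invertible change of generators modulo
`𝔪`. Translation keeps the linear part of `α`, so `r` has an entry with a nonzero linear term, and
homogeneity makes this entry a linear form (`basis_or_linear_relation`). -/

namespace HypArr

open MvPolynomial

/-! ### Saturated rank one submodules over a factorial domain -/

section Saturated

variable {R ι : Type*} [CommRing R] [IsDomain R] [IsNoetherianRing R]
  [UniqueFactorizationMonoid R] [Finite ι]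

/-- Over a factorial domain, a saturated rank one submodule of a free module of finite rank is
generated by a single vector. -/
theorem exists_eq_span_singleton_of_finrank_eq_one (N : Submodule R (ι → R))
    (hsat : ∀ (c : R) (v : ι → R), c ≠ 0 → c • v ∈ N → v ∈ N) (hN : Module.finrank R N = 1) :
    ∃ r : ι → R, r ≠ 0 ∧ N = Submodule.span R {r} := by
  classical
  have := Fintype.ofFinite ι
  obtain ⟨G⟩ : Nonempty (NormalizedGCDMonoid R) := inferInstance
  have hbot : N ≠ ⊥ := by
    rintro rfl
    simp at hN
  obtain ⟨v, hvN, hv⟩ := N.ne_bot_iff.mp hbot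
  obtain ⟨i₀, hi₀⟩ := Function.ne_iff.mp hv
  -- Dividing `v` by the gcd of its entries gives a primitive vector, which stays in `N` by
  -- saturation.
  obtain ⟨r, hr, hgcd⟩ := Finset.univ.extract_gcd v ⟨i₀, Finset.mem_univ _⟩
  have hvr : v = Finset.univ.gcd v • r := funext fun i => hr i (Finset.mem_univ i)
  have hc : Finset.univ.gcd v ≠ 0 := fun h => hv (by rw [hvr, h, zero_smul])
  have hrN : r ∈ N := hsat _ _ hc (hvr ▸ hvN)
  have hr0 : r ≠ 0 := fun h => hv (by rw [hvr, h, smul_zero])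
  refine ⟨r, hr0, le_antisymm (fun w hw => ?_) (by simpa using hrN)⟩
  obtain ⟨a, b, hab, h0⟩ : ∃ a b : R, a • w = b • r ∧ a ≠ 0 := by
    have hdep : ¬ LinearIndependent R ![(⟨w, hw⟩ : N), ⟨r, hrN⟩] := fun hli => by
      have := hli.fintype_card_le_finrank
      simp [hN] at this
    rw [LinearIndependent.pair_iff] at hdep
    push Not at hdep
    obtain ⟨s, t, hst, hne⟩ := hdep
    have hst' : s • w + t • r = 0 := congrArg Subtype.val hst
    refine ⟨s, -t, by rw [neg_smul]; exact eq_neg_of_add_eq_zero_left hst', fun hs => ?_⟩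
    rw [hs, zero_smul, zero_add, smul_eq_zero] at hst'
    exact hne hs (hst'.resolve_right hr0)
  -- `a` divides every `b * r i`, hence their gcd, which is `b` up to a unit because `r` is
  -- primitive.
  have hdvd : a ∣ b := by
    have h1 : a ∣ Finset.univ.gcd fun i => b * r i :=
      Finset.dvd_gcd fun i _ => ⟨w i, (congrFun hab i).symm⟩
    have h2 := Finset.gcd_mul_left' Finset.univ r b
    rw [hgcd, mul_one] at h2
    exact h1.trans h2.dvd
  obtain ⟨c, rfl⟩ := hdvd
  refine Submodule.mem_span_singleton.mpr ⟨c, ?_⟩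
  rw [mul_smul] at hab
  exact (smul_right_injective _ h0 hab).symm

end Saturated

/-! ### Ranks of submodules and of relation modules -/

section Rank

variable {R : Type*} [CommRing R] [IsDomain R]

/-- A submodule of a free module that contains a nonzero multiple of the free module has full
rank. -/
theorem finrank_eq_of_smul_mem {l : ℕ} (M : Submodule R (Fin l → R)) {Q : R} (hQ : Q ≠ 0)
    (h : ∀ x, Q • x ∈ M) : Module.finrank R M = l := by
  have hrank : Module.rank R M = l := by
    apply le_antisymm
    · simpa using M.rank_le
    · have := LinearMap.rank_le_of_injective
        (LinearMap.codRestrict M (Q • LinearMap.id : (Fin l → R) →ₗ[R] (Fin l → R)) h)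
        (fun x y hxy => smul_right_injective (Fin l → R) hQ (by simpa [Subtype.ext_iff] using hxy))
      simpa using this
  simp [Module.finrank, hrank]

/-- Rank and nullity for a finite family of generators. -/
theorem finrank_range_add_finrank_ker_linearCombination {l r : ℕ} (h : Fin r → Fin l → R) :
    Module.finrank R (Submodule.span R (Set.range h)) +
      Module.finrank R (LinearMap.ker (Fintype.linearCombination R h)) = r := by
  rw [← Fintype.range_linearCombination, ← LinearEquiv.finrank_eq
    (Fintype.linearCombination R h).quotKerEquivRange, Submodule.finrank_quotient_add_finrank]
  simp

end Rank

/-! ### Homogeneous components and the graded Nakayama lemma -/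

section Components

variable {K : Type*} [Field K] {l : ℕ}

/-- A polynomial lies in the ideal of the variables if and only if its constant term vanishes. -/
theorem mem_idealOfVars_iff_constantCoeff {σ : Type*} (p : MvPolynomial σ K) :
    p ∈ idealOfVars σ K ↔ constantCoeff p = 0 := by
  rw [← pow_one (idealOfVars σ K), mem_pow_idealOfVars_iff']
  simp [constantCoeff_eq, Finsupp.degree_eq_zero_iff]

theorem constantCoeff_pderiv {σ : Type*} (i : σ) (p : MvPolynomial σ K) :
    constantCoeff (pderiv i p) = p.coeff (Finsupp.single i 1) := by
  simp [constantCoeff_eq, coeff_pderiv]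

/-- The component in degree `k` of a coefficient in a free module summand with shift `a`. -/
noncomputable def twistedComponent (a k : ℕ) (p : MvPolynomial (Fin l) K) :
    MvPolynomial (Fin l) K :=
  -- Subtraction truncates: without the guard, degrees `k < a` would pick up the constant term of
  -- `p`.
  if a ≤ k then homogeneousComponent (k - a) p else 0

theorem coeff_twistedComponent (a k : ℕ) (p : MvPolynomial (Fin l) K) (m : Fin l →₀ ℕ) :
    (twistedComponent a k p).coeff m = if a + m.degree = k then p.coeff m else 0 := by
  rw [twistedComponent]
  split_ifs with h1 h2 h2
  · rw [coeff_homogeneousComponent, if_pos (by omega)]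
  · rw [coeff_homogeneousComponent, if_neg (by omega)]
  · omega
  · simp

theorem homogeneousComponent_mul_of_isHomogeneous {a : ℕ} {q : MvPolynomial (Fin l) K}
    (hq : q.IsHomogeneous a) (k : ℕ) (p : MvPolynomial (Fin l) K) :
    homogeneousComponent k (p * q) = twistedComponent a k p * q := by
  classical
  ext m
  rw [coeff_homogeneousComponent, coeff_mul, coeff_mul]
  trans ∑ x ∈ Finset.HasAntidiagonal.antidiagonal m,
    if m.degree = k then coeff x.1 p * coeff x.2 q else 0
  · split_ifs <;> simp
  refine Finset.sum_congr rfl fun x hx => ?_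
  have hdeg : x.1.degree + x.2.degree = m.degree := by
    rw [← map_add, Finset.HasAntidiagonal.mem_antidiagonal.mp hx]
  rw [coeff_twistedComponent]
  by_cases hx2 : x.2.degree = a
  · simp only [show (a + x.1.degree = k) = (m.degree = k) by rw [← hdeg, hx2, add_comm], ite_mul,
      zero_mul]
  · simp [hq.coeff_eq_zero hx2]

/-- A generator of a cyclic module of relations that is closed under taking twisted components is
twisted homogeneous. -/
theorem exists_isTwistedHomogeneous_of_span_singleton {ι : Type*} (a : ι → ℕ)
    (r : ι → MvPolynomial (Fin l) K) (hr : r ≠ 0)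
    (hN : ∀ k, ∃ c : MvPolynomial (Fin l) K, (fun i => twistedComponent (a i) k (r i)) = c • r) :
    ∃ k, IsTwistedHomogeneous a k r := by
  obtain ⟨j, hj⟩ := Function.ne_iff.mp hr
  rw [Pi.zero_apply] at hj
  refine ⟨a j + (r j).totalDegree, ?_⟩
  obtain ⟨c, hc⟩ := hN (a j + (r j).totalDegree)
  have hcj := congrFun hc j
  have hcomp : twistedComponent (a j) (a j + (r j).totalDegree) (r j) =
      homogeneousComponent (r j).totalDegree (r j) := by
    simp [twistedComponent]
  have hne : homogeneousComponent (r j).totalDegree (r j) ≠ 0 := by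
    obtain ⟨m, hm, hmd⟩ := (r j).support.exists_mem_eq_sup (support_nonempty.mpr hj)
      fun m => m.toMultiset.card
    rw [← totalDegree_eq] at hmd
    intro h0
    have := congrArg (coeff m) h0
    rw [coeff_homogeneousComponent, if_pos (by rw [hmd, Finsupp.card_toMultiset]; rfl)] at this
    exact mem_support_iff.mp hm (by simpa using this)
  simp only [Pi.smul_apply, smul_eq_mul, hcomp] at hcj
  -- The multiplier `c` takes `r j` to its own top component, so comparing total degrees makes it a
  -- nonzero constant; all entries of `r` are then concentrated in twisted degree `k`.
  have hc0 : c ≠ 0 := by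
    rintro rfl
    exact hne (by simpa using hcj)
  have hdeg := (homogeneousComponent_isHomogeneous (r j).totalDegree (r j)).totalDegree hne
  rw [hcj, totalDegree_mul_of_isDomain hc0 hj] at hdeg
  obtain ⟨c₀, rfl⟩ : ∃ c₀, c = C c₀ := ⟨_, totalDegree_eq_zero_iff_eq_C.mp (by omega)⟩
  intro i m hm
  by_contra hne'
  have := congrArg (coeff m) (congrFun hc i)
  rw [coeff_twistedComponent, if_neg hne'] at this
  simp [hm] at this
  exact hc0 (by simp [this])

/-- The component of degree `k` of a vector of polynomials. -/
noncomputable def vectorComponent (k : ℕ) :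
    (Fin l → MvPolynomial (Fin l) K) →ₗ[K] (Fin l → MvPolynomial (Fin l) K) :=
  (homogeneousComponent k).compLeft (Fin l)

@[simp]
theorem vectorComponent_apply (k : ℕ) (x : Fin l → MvPolynomial (Fin l) K) (i : Fin l) :
    vectorComponent k x i = homogeneousComponent k (x i) := rfl

theorem vectorComponent_isHomogeneous (k : ℕ) (x : Fin l → MvPolynomial (Fin l) K) (i : Fin l) :
    (vectorComponent k x i).IsHomogeneous k :=
  homogeneousComponent_isHomogeneous _ _

theorem vectorComponent_smul {a : ℕ} {x : Fin l → MvPolynomial (Fin l) K}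
    (hx : ∀ i, (x i).IsHomogeneous a) (k : ℕ) (p : MvPolynomial (Fin l) K) :
    vectorComponent k (p • x) = twistedComponent a k p • x := by
  ext1 i
  simp [homogeneousComponent_mul_of_isHomogeneous (hx i)]

/-- Multiplication by a variable raises the degree by one; this drives the induction in the graded
Nakayama lemma. -/
theorem vectorComponent_X_smul (j : Fin l) (k : ℕ) (x : Fin l → MvPolynomial (Fin l) K) :
    vectorComponent k ((X j : MvPolynomial (Fin l) K) • x) =
      if 1 ≤ k then (X j : MvPolynomial (Fin l) K) • vectorComponent (k - 1) x else 0 := by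
  ext1 i
  simp only [vectorComponent_apply, Pi.smul_apply, smul_eq_mul]
  rw [mul_comm, homogeneousComponent_mul_of_isHomogeneous (isHomogeneous_X K j), twistedComponent]
  split_ifs <;> simp [mul_comm]

theorem exists_sum_vectorComponent (x : Fin l → MvPolynomial (Fin l) K) :
    ∃ N, x = ∑ k ∈ Finset.range N, vectorComponent k x := by
  refine ⟨Finset.univ.sup (fun i => (x i).totalDegree) + 1, ?_⟩
  ext1 i
  simp only [Finset.sum_apply, vectorComponent_apply]
  have hle : (x i).totalDegree ≤ Finset.univ.sup (fun i => (x i).totalDegree) :=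
    Finset.le_sup (f := fun i => (x i).totalDegree) (Finset.mem_univ i)
  conv_lhs => rw [← sum_homogeneousComponent (x i)]
  refine Finset.sum_subset (by intro; simp; omega) fun k _ hk => ?_
  exact homogeneousComponent_eq_zero _ _ (by simp at hk; omega)

/-- Elements of `𝔪 M` are the combinations of elements of `M` with the variables. -/
theorem exists_of_mem_idealOfVars_smul {M : Submodule (MvPolynomial (Fin l) K)
    (Fin l → MvPolynomial (Fin l) K)} {x : Fin l → MvPolynomial (Fin l) K}
    (hx : x ∈ idealOfVars (Fin l) K • M) :
    ∃ y : Fin l → (Fin l → MvPolynomial (Fin l) K), (∀ j, y j ∈ M) ∧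
      x = ∑ j, (X j : MvPolynomial (Fin l) K) • y j := by
  induction hx using Submodule.smul_induction_on' with
  | smul p hp y hy =>
    obtain ⟨c, rfl⟩ := (Ideal.mem_span_range_iff_exists_fun).mp hp
    exact ⟨fun j => c j • y, fun j => M.smul_mem _ hy, by
      simp [Finset.sum_smul, smul_smul, mul_comm]⟩
  | add x _ y _ hx hy =>
    obtain ⟨u, hu, rfl⟩ := hx
    obtain ⟨v, hv, rfl⟩ := hy
    exact ⟨u + v, fun j => add_mem (hu j) (hv j), by simp [Finset.sum_add_distrib]⟩

/-- Graded Nakayama lemma: homogeneous elements of a submodule `M` that generate `M`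
modulo `𝔪 M` generate `M`. -/
theorem span_eq_of_span_sup_idealOfVars_smul {ι : Type*} [Finite ι]
    {M : Submodule (MvPolynomial (Fin l) K) (Fin l → MvPolynomial (Fin l) K)}
    {h : ι → (Fin l → MvPolynomial (Fin l) K)} {a : ι → ℕ} (hh : ∀ j, h j ∈ M)
    (hhom : ∀ j i, (h j i).IsHomogeneous (a j))
    (hspan : M ≤ Submodule.span _ (Set.range h) ⊔ idealOfVars (Fin l) K • M) :
    Submodule.span (MvPolynomial (Fin l) K) (Set.range h) = M := by
  have := Fintype.ofFinite ι
  have hgr : ∀ x ∈ Submodule.span (MvPolynomial (Fin l) K) (Set.range h), ∀ k,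
      vectorComponent k x ∈ Submodule.span (MvPolynomial (Fin l) K) (Set.range h) := by
    intro x hx k
    obtain ⟨c, rfl⟩ := (Submodule.mem_span_range_iff_exists_fun _).mp hx
    rw [map_sum]
    refine sum_mem fun j _ => ?_
    rw [vectorComponent_smul (hhom j)]
    exact Submodule.smul_mem _ _ (Submodule.subset_span ⟨j, rfl⟩)
  refine le_antisymm (Submodule.span_le.mpr (by rintro _ ⟨j, rfl⟩; exact hh j)) ?_
  -- Induction on the degree: the part of `x` in `𝔪 M` contributes nothing in degree zero, and in
  -- degree `k + 1` only variables times degree `k` components of elements of `M`.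
  have key : ∀ k, ∀ x ∈ M,
      vectorComponent k x ∈ Submodule.span (MvPolynomial (Fin l) K) (Set.range h) := by
    intro k
    induction k with
    | zero =>
      intro x hx
      obtain ⟨u, hu, v, hv, rfl⟩ := Submodule.mem_sup.mp (hspan hx)
      obtain ⟨y, hy, rfl⟩ := exists_of_mem_idealOfVars_smul hv
      rw [map_add, map_sum]
      exact add_mem (hgr u hu _) (sum_mem fun j _ => by simp [vectorComponent_X_smul])
    | succ k ih =>
      intro x hx
      obtain ⟨u, hu, v, hv, rfl⟩ := Submodule.mem_sup.mp (hspan hx)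
      obtain ⟨y, hy, rfl⟩ := exists_of_mem_idealOfVars_smul hv
      rw [map_add, map_sum]
      refine add_mem (hgr u hu _) (sum_mem fun j _ => ?_)
      simpa [vectorComponent_X_smul] using Submodule.smul_mem _ _ (ih _ (hy j))
  intro x hx
  obtain ⟨N, hN⟩ := exists_sum_vectorComponent x
  rw [hN]
  exact sum_mem fun k _ => key k x hx

end Components

/-! ### Minimal generators and the dichotomy for the relation module -/

section Structure

variable {K : Type*} [Field K] {l : ℕ}

/-- A graded submodule generated modulo `𝔪 M` by `s` elements over `K` has a family of at most `s`
homogeneous generators that is linearly independent modulo `𝔪 M`. -/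
theorem exists_minimal_homogeneous_generators
    {M : Submodule (MvPolynomial (Fin l) K) (Fin l → MvPolynomial (Fin l) K)}
    (hM : ∀ x ∈ M, ∀ k, vectorComponent k x ∈ M) {s : ℕ}
    (n : Fin s → (Fin l → MvPolynomial (Fin l) K))
    (hn : ∀ y ∈ M, ∃ c : Fin s → K, y - ∑ j, c j • n j ∈ idealOfVars (Fin l) K • M) :
    ∃ r ≤ s, ∃ (h : Fin r → (Fin l → MvPolynomial (Fin l) K)) (a : Fin r → ℕ),
      (∀ j i, (h j i).IsHomogeneous (a j)) ∧
      Submodule.span (MvPolynomial (Fin l) K) (Set.range h) = M ∧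
      ∀ c : Fin r → K, ∑ j, c j • h j ∈ idealOfVars (Fin l) K • M → c = 0 := by
  classical
  let P : Submodule K (Fin l → MvPolynomial (Fin l) K) :=
    (idealOfVars (Fin l) K • M).restrictScalars K
  let ι := {x : Fin l → MvPolynomial (Fin l) K // x ∈ M ∧ ∃ d, ∀ i, (x i).IsHomogeneous d}
  -- Selecting a basis among the classes of homogeneous elements of `M` gives homogeneous lifts
  -- directly; the classes of the `n j` bound its size by `s`.
  obtain ⟨κ, a, -, hspan, hli⟩ := exists_linearIndependent' K (fun x : ι => P.mkQ x.1)
  have hle : Set.range ((fun x : ι => P.mkQ x.1) ∘ a) ≤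
      Submodule.span K (Set.range fun j => P.mkQ (n j)) := by
    rintro _ ⟨t, rfl⟩
    obtain ⟨c, hc⟩ := hn _ (a t).2.1
    refine (Submodule.mem_span_range_iff_exists_fun _).mpr ⟨c, ?_⟩
    have : P.mkQ ((a t).1 - ∑ j, c j • n j) = 0 := by
      rw [Submodule.mkQ_apply, Submodule.Quotient.mk_eq_zero]
      exact hc
    rw [map_sub, sub_eq_zero] at this
    simp only [Function.comp_apply, this, map_sum, map_smul]
  have hfin : Finite κ := hli.finite_of_le_span_finite _ _ hle
  have := Fintype.ofFinite κ
  have hcard : Fintype.card κ ≤ s := by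
    refine (linearIndependent_le_span_aux' _ hli _ hle).trans ?_
    simpa using Fintype.card_range_le fun j => P.mkQ (n j)
  let e := (Fintype.equivFin κ).symm
  choose d hd using fun j => (a (e j)).2.2
  have hspan' : M ≤ Submodule.span _ (Set.range fun j => (a (e j)).1) ⊔
      idealOfVars (Fin l) K • M := by
    have hhom : ∀ x ∈ M, ∀ k, vectorComponent k x ∈ Submodule.span (MvPolynomial (Fin l) K)
        (Set.range fun j => (a (e j)).1) ⊔ idealOfVars (Fin l) K • M := by
      intro x hx k
      have hmem : P.mkQ (vectorComponent k x) ∈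
          Submodule.span K (Set.range ((fun x : ι => P.mkQ x.1) ∘ a)) := by
        rw [hspan]
        exact Submodule.subset_span
          ⟨⟨vectorComponent k x, hM x hx k, k, vectorComponent_isHomogeneous k x⟩, rfl⟩
      obtain ⟨c, hc⟩ := (Submodule.mem_span_range_iff_exists_fun _).mp hmem
      have hP : vectorComponent k x - ∑ t, c t • (a t).1 ∈ P := by
        rw [← Submodule.Quotient.mk_eq_zero, ← Submodule.mkQ_apply, map_sub, ← hc, map_sum]
        simp
      rw [← sub_add_cancel (vectorComponent k x) (∑ t, c t • (a t).1)]
      refine add_mem (Submodule.mem_sup_right hP) (Submodule.mem_sup_left (sum_mem fun t _ => ?_))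
      rw [← algebraMap_smul (MvPolynomial (Fin l) K)]
      exact Submodule.smul_mem _ _ (Submodule.subset_span ⟨e.symm t, by simp⟩)
    intro x hx
    obtain ⟨N, hN⟩ := exists_sum_vectorComponent x
    rw [hN]
    exact sum_mem fun k _ => hhom x hx k
  refine ⟨Fintype.card κ, hcard, fun j => (a (e j)).1, d, hd,
    span_eq_of_span_sup_idealOfVars_smul (fun j => (a (e j)).2.1) hd hspan', fun c hc => ?_⟩
  have hli' := hli.comp e e.injective
  rw [Fintype.linearIndependent_iff] at hli'
  refine funext (hli' c ?_)
  have : P.mkQ (∑ j, c j • (a (e j)).1) = 0 := by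
    rw [Submodule.mkQ_apply, Submodule.Quotient.mk_eq_zero]
    exact hc
  simpa using this

/-- Reduction modulo `𝔪 M` of a combination of elements of `M`. -/
theorem sum_smul_sub_constantCoeff_smul_mem {ι : Type*} [Fintype ι]
    {M : Submodule (MvPolynomial (Fin l) K) (Fin l → MvPolynomial (Fin l) K)}
    {h : ι → (Fin l → MvPolynomial (Fin l) K)} (hh : ∀ j, h j ∈ M)
    (v : ι → MvPolynomial (Fin l) K) :
    ∑ j, v j • h j - ∑ j, constantCoeff (v j) • h j ∈ idealOfVars (Fin l) K • M := by
  rw [← Finset.sum_sub_distrib]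
  refine sum_mem fun j _ => ?_
  rw [← algebraMap_smul (MvPolynomial (Fin l) K) (constantCoeff (v j)), ← sub_smul]
  exact Submodule.smul_mem_smul
    ((mem_idealOfVars_iff_constantCoeff _).mpr (by simp [algebraMap_eq])) (hh j)

/-- The structure of a graded submodule `M` of full rank that is generated modulo `𝔪 M` by
`l + 1` elements satisfying a relation with an entry that has a nonzero linear term. -/
theorem basis_or_linear_relation
    {M : Submodule (MvPolynomial (Fin l) K) (Fin l → MvPolynomial (Fin l) K)}
    (hM : ∀ x ∈ M, ∀ k, vectorComponent k x ∈ M)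
    {Q : MvPolynomial (Fin l) K} (hQ : Q ≠ 0) (hQM : ∀ x, Q • x ∈ M)
    (n : Fin (l + 1) → (Fin l → MvPolynomial (Fin l) K)) (hnM : ∀ j, n j ∈ M)
    (hn : ∀ y ∈ M, ∃ c : Fin (l + 1) → K, y - ∑ j, c j • n j ∈ idealOfVars (Fin l) K • M)
    (e : Fin (l + 1) → MvPolynomial (Fin l) K) (he : ∑ j, e j • n j = 0)
    (j₀ : Fin (l + 1)) (i₀ : Fin l) (hlin : constantCoeff (pderiv i₀ (e j₀)) ≠ 0) :
    (∃ (h : Fin l → (Fin l → MvPolynomial (Fin l) K)) (a : Fin l → ℕ),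
      (∀ j i, (h j i).IsHomogeneous (a j)) ∧ LinearIndependent (MvPolynomial (Fin l) K) h ∧
      Submodule.span (MvPolynomial (Fin l) K) (Set.range h) = M) ∨
    ∃ (h : Fin (l + 1) → (Fin l → MvPolynomial (Fin l) K)) (a : Fin (l + 1) → ℕ)
      (r : Fin (l + 1) → MvPolynomial (Fin l) K) (j : Fin (l + 1)),
      (∀ j i, (h j i).IsHomogeneous (a j)) ∧
      Submodule.span (MvPolynomial (Fin l) K) (Set.range h) = M ∧
      (∀ v : Fin (l + 1) → MvPolynomial (Fin l) K,
        ∑ j, v j • h j = 0 ↔ ∃ c : MvPolynomial (Fin l) K, v = c • r) ∧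
      IsTwistedHomogeneous a (a j + 1) r ∧ r j ≠ 0 ∧ ∀ j, r j ∈ idealOfVars (Fin l) K := by
  obtain ⟨s, hs, h, a, hhom, hspan, hind⟩ := exists_minimal_homogeneous_generators hM n hn
  have hhM : ∀ j, h j ∈ M := fun j => hspan ▸ Submodule.subset_span ⟨j, rfl⟩
  have hrank := finrank_range_add_finrank_ker_linearCombination h
  rw [hspan, finrank_eq_of_smul_mem M hQ hQM] at hrank
  -- The image has rank `l`, so rank-nullity gives `l ≤ s`, while `s ≤ l + 1`.
  obtain rfl | rfl : s = l ∨ s = l + 1 := by omega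
  · left
    refine ⟨h, a, hhom, ?_, hspan⟩
    have hker : Module.finrank (MvPolynomial (Fin s) K)
      (LinearMap.ker (Fintype.linearCombination (MvPolynomial (Fin s) K) h)) = 0 := by omega
    rw [Fintype.linearIndependent_iff]
    rw [Submodule.finrank_eq_zero] at hker
    intro v hv
    have : v ∈ LinearMap.ker (Fintype.linearCombination (MvPolynomial (Fin s) K) h) := by
      simpa [Fintype.linearCombination_apply] using hv
    rw [hker] at this
    exact congrFun this
  right
  have hker : Module.finrank (MvPolynomial (Fin l) K)
    (LinearMap.ker (Fintype.linearCombination (MvPolynomial (Fin l) K) h)) = 1 := by omega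
  obtain ⟨r, hr0, hr⟩ := exists_eq_span_singleton_of_finrank_eq_one _ (fun c v hc hv => by
    rw [LinearMap.mem_ker, map_smul] at hv
    exact (smul_eq_zero.mp hv).resolve_left hc) hker
  have hrel : ∀ v : Fin (l + 1) → MvPolynomial (Fin l) K,
      ∑ j, v j • h j = 0 ↔ ∃ c : MvPolynomial (Fin l) K, v = c • r := by
    intro v
    rw [← Fintype.linearCombination_apply, ← LinearMap.mem_ker, hr, Submodule.mem_span_singleton]
    simp only [eq_comm]
  have hrh : ∑ j, r j • h j = 0 := (hrel r).mpr ⟨1, by simp⟩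
  have hmin : ∀ v : Fin (l + 1) → MvPolynomial (Fin l) K, ∑ j, v j • h j = 0 →
      ∀ j, constantCoeff (v j) = 0 := by
    intro v hv
    have := sum_smul_sub_constantCoeff_smul_mem hhM v
    rw [hv, zero_sub, neg_mem_iff] at this
    exact congrFun (hind _ this)
  -- Each component of the relation `r` is again a relation, hence a multiple of `r`.
  obtain ⟨k, hk⟩ := exists_isTwistedHomogeneous_of_span_singleton a r hr0 fun k => by
    rw [← hrel]
    have := congrArg (vectorComponent k) hrh
    rw [map_sum, map_zero] at this
    rw [← this]
    exact Finset.sum_congr rfl fun j _ => (vectorComponent_smul (hhom j) k (r j)).symm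
  have hb : ∀ j, ∃ b : Fin (l + 1) → MvPolynomial (Fin l) K, ∑ i, b i • h i = n j := fun j =>
    (Submodule.mem_span_range_iff_exists_fun _).mp (hspan.symm ▸ hnM j)
  choose b hb using hb
  choose c hc using fun i => hn (h i) (hhM i)
  let B : Matrix (Fin (l + 1)) (Fin (l + 1)) K := .of fun j i => constantCoeff (b j i)
  -- Modulo `𝔪 M`, `c` expresses `h` through `n` and `B` expresses `n` through `h`. The rows of `1 -
  -- c B` are therefore relations on `h` over `K`, and these vanish.
  have hCB : Matrix.of c * B = 1 := by
    rw [← sub_eq_zero, ← neg_eq_zero, neg_sub]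
    refine Matrix.ext fun i => congrFun (hind ((1 - Matrix.of c * B) i) ?_)
    have h1 : ∑ j, c i j • (n j - ∑ k, B j k • h k) ∈ idealOfVars (Fin l) K • M := by
      refine sum_mem fun j _ => ?_
      rw [← algebraMap_smul (MvPolynomial (Fin l) K) (c i j), ← hb j]
      exact Submodule.smul_mem _ _ (sum_smul_sub_constantCoeff_smul_mem hhM (b j))
    have h2 := add_mem (hc i) h1
    convert h2 using 1
    simp only [Matrix.sub_apply, sub_smul, Finset.sum_sub_distrib, smul_sub, Matrix.mul_apply,
      Matrix.one_apply, ite_smul, one_smul, zero_smul, Finset.sum_ite_eq, Finset.mem_univ, if_true,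
      Finset.sum_smul, Finset.smul_sum, mul_smul, Matrix.of_apply]
    rw [Finset.sum_comm]
    abel
  -- There are as many `n` as `h`, so the matrices are square and a one-sided inverse suffices.
  have hBC : B * Matrix.of c = 1 := mul_eq_one_comm.mp hCB
  have hBinj : ∀ u : Fin (l + 1) → K, Matrix.vecMul u B = 0 → u = 0 := fun u hu => by
    rw [← Matrix.vecMul_one u, ← hBC, ← Matrix.vecMul_vecMul, hu, Matrix.zero_vecMul]
  have heb : ∑ i, (∑ j, e j * b j i) • h i = 0 := by
    simp only [Finset.sum_smul, mul_smul]
    rw [Finset.sum_comm]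
    simp only [← Finset.smul_sum, hb, he]
  have he0 : ∀ j, constantCoeff (e j) = 0 := by
    refine congrFun (hBinj (fun j => constantCoeff (e j)) ?_)
    ext i
    simpa [Matrix.vecMul, dotProduct, B] using hmin _ heb i
  obtain ⟨q, hq⟩ := (hrel _).mp heb
  -- Differentiate `∑ j, e j * b j i = q * r i` at the origin. As `e` and `r` have no constant
  -- terms, this leaves `∂e(0) B = q(0) ∂r(0)`; if `∂r(0)` vanished, so would `∂e(0)`, against
  -- `hlin`.
  obtain ⟨j, hj⟩ : ∃ j, constantCoeff (pderiv i₀ (r j)) ≠ 0 := by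
    by_contra! hcon
    refine hlin (congrFun (hBinj (fun j => constantCoeff (pderiv i₀ (e j))) ?_) j₀)
    ext i
    have := congrArg (fun f => constantCoeff (pderiv i₀ f)) (congrFun hq i)
    simpa [Matrix.vecMul, dotProduct, B, Derivation.leibniz, he0, hcon, hmin r hrh, mul_comm]
      using this
  rw [constantCoeff_pderiv] at hj
  -- A nonzero linear coefficient in the entry `r j` forces the twisted degree of `r` to be `a j +
  -- 1`.
  have hkj := hk j _ hj
  rw [Finsupp.degree_single] at hkj
  subst hkj
  exact ⟨h, a, r, j, hhom, hspan, hrel, hk, fun h0 => hj (by simp [h0]),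
    fun j => (mem_idealOfVars_iff_constantCoeff _).mpr (hmin r hrh j)⟩

end Structure

/-! ### Logarithmic vector fields as vectors of polynomials -/

section Arrangement

variable {K : Type*} [Field K] {l : ℕ}

/-- The coefficients of a polynomial vector field. -/
noncomputable def coefficients :
    VectorField K l ≃ₗ[MvPolynomial (Fin l) K] (Fin l → MvPolynomial (Fin l) K) where
  toFun δ i := δ (X i)
  map_add' _ _ := rfl
  map_smul' _ _ := rfl
  invFun := mkDerivation K
  left_inv δ := derivation_ext fun i => by simp
  right_inv x := by ext1 i; simp

@[simp]
theorem coefficients_apply (δ : VectorField K l) (i : Fin l) : coefficients δ i = δ (X i) := rfl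

/-- The coefficient vectors of the vector fields in `D(A)`. -/
noncomputable def CentralArrangement.logVectors (A : CentralArrangement K l) :
    Submodule (MvPolynomial (Fin l) K) (Fin l → MvPolynomial (Fin l) K) :=
  A.logDer.map (coefficients (K := K) (l := l)).toLinearMap

theorem derivation_linearForm (δ : VectorField K l) (φ : Module.Dual K (Fin l → K)) :
    δ (linearForm φ) = ∑ i, C (φ (Pi.single i 1)) * coefficients δ i := by
  simp [linearForm, Derivation.leibniz]

theorem CentralArrangement.coefficients_mem_logVectors {A : CentralArrangement K l}
    {δ : VectorField K l} : coefficients δ ∈ A.logVectors ↔ δ ∈ A.logDer :=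
  (Submodule.mem_map_equiv A.logDer).trans (by simp)

theorem CentralArrangement.mem_logVectors {A : CentralArrangement K l}
    {x : Fin l → MvPolynomial (Fin l) K} :
    x ∈ A.logVectors ↔ ∀ H ∈ A.hyperplanes, ∀ φ : Module.Dual K (Fin l → K),
      LinearMap.ker φ = H → linearForm φ ∣ ∑ i, C (φ (Pi.single i 1)) * x i := by
  obtain ⟨δ, rfl⟩ := coefficients.surjective x
  rw [coefficients_mem_logVectors]
  simp only [← derivation_linearForm, ← Ideal.mem_span_singleton]
  rfl

theorem linearForm_isHomogeneous (φ : Module.Dual K (Fin l → K)) :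
    (linearForm φ).IsHomogeneous 1 :=
  IsHomogeneous.sum _ _ _ fun i _ => isHomogeneous_C_mul_X _ i

theorem eval_linearForm (p : Fin l → K) (φ : Module.Dual K (Fin l → K)) :
    eval p (linearForm φ) = φ p := by
  rw [LinearMap.pi_apply_eq_sum_univ φ p]
  simp only [linearForm, map_sum, map_mul, eval_C, eval_X, smul_eq_mul]
  refine Finset.sum_congr rfl fun i _ => ?_
  rw [mul_comm]
  congr 2
  ext j
  simp [Pi.single_apply, eq_comm]

theorem linearForm_smul (c : K) (φ : Module.Dual K (Fin l → K)) :
    linearForm (c • φ) = C c * linearForm φ := by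
  simp [linearForm, Finset.mul_sum, mul_assoc]

/-- The divisibility conditions are graded because the defining forms are homogeneous: the quotient
has only to be replaced by its component of degree one less. -/
theorem CentralArrangement.vectorComponent_mem_logVectors (A : CentralArrangement K l)
    {x : Fin l → MvPolynomial (Fin l) K} (hx : x ∈ A.logVectors) (k : ℕ) :
    vectorComponent k x ∈ A.logVectors := by
  rw [mem_logVectors] at hx ⊢
  intro H hH φ hφ
  obtain ⟨c, hc⟩ := hx H hH φ hφ
  refine ⟨twistedComponent 1 k c, ?_⟩
  have := congrArg (homogeneousComponent k) hc
  rw [mul_comm, homogeneousComponent_mul_of_isHomogeneous (linearForm_isHomogeneous φ),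
    mul_comm, map_sum] at this
  simpa [homogeneousComponent_C_mul] using this

/-- A product of defining linear forms of finitely many hyperplanes. -/
theorem exists_defining_polynomial (s : Finset (Submodule K (Fin l → K)))
    (hs : ∀ H ∈ s, IsCoatom H) :
    ∃ Q : MvPolynomial (Fin l) K, Q ≠ 0 ∧
      (∀ H ∈ s, ∀ φ : Module.Dual K (Fin l → K), LinearMap.ker φ = H → linearForm φ ∣ Q) ∧
      ∀ p : Fin l → K, (∀ H ∈ s, p ∉ H) → eval p Q ≠ 0 := by
  classical
  induction s using Finset.induction_on with
  | empty => exact ⟨1, one_ne_zero, by simp, by simp⟩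
  | insert H s hHs ih =>
    obtain ⟨Q, hQ, hdvd, hev⟩ := ih fun H hH => hs H (Finset.mem_insert_of_mem hH)
    by_cases hφ : ∃ φ : Module.Dual K (Fin l → K), LinearMap.ker φ = H
    · obtain ⟨φ, rfl⟩ := hφ
      obtain ⟨x, hx⟩ : ∃ x, φ x ≠ 0 := by
        by_contra! hcon
        exact (hs _ (Finset.mem_insert_self _ _)).1 
          (LinearMap.ker_eq_top.mpr (LinearMap.ext hcon))
      refine ⟨linearForm φ * Q, mul_ne_zero (fun h0 => hx ?_) hQ, ?_, fun p hp => ?_⟩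
      · rw [← eval_linearForm, h0, map_zero]
      · intro H' hH' ψ hψ
        obtain rfl | hH' := Finset.mem_insert.mp hH'
        · have hψφ : φ = (φ x / ψ x) • ψ := by
            have hψx : ψ x ≠ 0 := fun h => hx (by
              rw [← LinearMap.mem_ker, ← hψ]; exact h)
            refine LinearMap.ext fun y => ?_
            have hy : y - (ψ y / ψ x) • x ∈ LinearMap.ker φ := by
              rw [← hψ, LinearMap.mem_ker]
              simp [hψx]
            rw [LinearMap.mem_ker, map_sub, map_smul, sub_eq_zero] at hy
            rw [hy]
            simp only [smul_eq_mul, LinearMap.smul_apply]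
            ring
          rw [hψφ, linearForm_smul]
          exact Dvd.intro_left _ rfl |>.mul_right _
        · exact (hdvd H' hH' ψ hψ).mul_left _
      · rw [map_mul, eval_linearForm]
        exact mul_ne_zero (hp _ (Finset.mem_insert_self _ _))
          (hev p fun H hH => hp H (Finset.mem_insert_of_mem hH))
    · refine ⟨Q, hQ, fun H' hH' ψ hψ => ?_, fun p hp =>
        hev p fun H hH => hp H (Finset.mem_insert_of_mem hH)⟩
      obtain rfl | hH' := Finset.mem_insert.mp hH'
      · exact absurd ⟨ψ, hψ⟩ hφ
      · exact hdvd H' hH' ψ hψ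

/-! ### Translation to a point of the flat -/

/-- Translation of polynomials by a vector. -/
noncomputable def translateHom (p : Fin l → K) :
    MvPolynomial (Fin l) K →ₐ[K] MvPolynomial (Fin l) K :=
  aeval fun i => X i + C (p i)

theorem translate_X (p : Fin l → K) (i : Fin l) : translateHom p (X i) = X i + C (p i) := by
  simp [translateHom]

theorem translate_C (p : Fin l → K) (c : K) : translateHom p (C c) = C c := by
  simp [translateHom, algebraMap_eq]

theorem translate_translate_neg (p : Fin l → K) (f : MvPolynomial (Fin l) K) :
    translateHom p (translateHom (-p) f) = f := by
  have : (translateHom p).comp (translateHom (-p)) = AlgHom.id K _ := by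
    ext1 i
    simp [translate_X]
  exact DFunLike.congr_fun this f

theorem constantCoeff_translate (p : Fin l → K) (f : MvPolynomial (Fin l) K) :
    constantCoeff (translateHom p f) = eval p f := by
  have : (constantCoeff (R := K) (σ := Fin l)).comp (translateHom p : _ →+* _) = eval p := by
    ext i
    · simp
    · simp [translate_X]
  exact DFunLike.congr_fun this f

theorem translate_linearForm (p : Fin l → K) (φ : Module.Dual K (Fin l → K)) :
    translateHom p (linearForm φ) = linearForm φ + C (φ p) := by
  rw [← eval_linearForm p φ]
  simp [linearForm, translate_X, mul_add, Finset.sum_add_distrib]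

/-- A point common to all hyperplanes is a zero of every defining form, so the translation fixes
these forms and preserves divisibility by them. -/
theorem CentralArrangement.translate_mem_logVectors (A : CentralArrangement K l)
    {p : Fin l → K} (hp : ∀ H ∈ A.hyperplanes, p ∈ H)
    {x : Fin l → MvPolynomial (Fin l) K} (hx : x ∈ A.logVectors) :
    (fun i => translateHom p (x i)) ∈ A.logVectors := by
  rw [mem_logVectors] at hx ⊢
  intro H hH φ hφ
  have hφp : φ p = 0 := by
    have := hp H hH
    rwa [← hφ] at this
  have := map_dvd (translateHom p) (hx H hH φ hφ)
  simpa [translate_linearForm, hφp, translate_C] using this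

/-- Translation changes a linear form only by a constant, so its derivatives at the origin are still
its coefficients. -/
theorem exists_constantCoeff_pderiv_translate_ne_zero {α : MvPolynomial (Fin l) K} (hα : α ≠ 0)
    (hhom : α.IsHomogeneous 1) (p : Fin l → K) :
    ∃ i, constantCoeff (pderiv i (translateHom p α)) ≠ 0 := by
  have hmem : α ∈ homogeneousSubmodule (Fin l) K 1 := hhom
  rw [homogeneousSubmodule_one_eq_span_X] at hmem
  obtain ⟨c, rfl⟩ := (Submodule.mem_span_range_iff_exists_fun K).mp hmem
  by_contra! hcon
  refine hα (Finset.sum_eq_zero fun i _ => ?_)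
  have := hcon i
  simp [translate_X, pderiv_X, Pi.single_apply] at this
  simp [this]

/-- A vector space over an infinite field is not a finite union of proper subspaces, so a subspace
has a point outside of finitely many subspaces that do not contain it. -/
theorem exists_mem_forall_notMem [Infinite K] (X : Submodule K (Fin l → K))
    (s : Finset (Submodule K (Fin l → K))) (hs : ∀ H ∈ s, ¬ X ≤ H) :
    ∃ p ∈ X, ∀ H ∈ s, p ∉ H := by
  by_contra! hcon
  obtain ⟨H, hH⟩ := Subspace.exists_eq_top_of_iUnion_eq_univ
    (p := fun H : s => H.1.comap X.subtype) (Set.eq_univ_of_forall fun p => by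
      obtain ⟨H, hH, hp⟩ := hcon p.1 p.2
      exact Set.mem_iUnion.mpr ⟨⟨H, hH⟩, hp⟩)
  refine hs H H.2 fun x hx => ?_
  have : (⟨x, hx⟩ : X) ∈ H.1.comap X.subtype := hH ▸ Submodule.mem_top
  exact this

/-! ### From generators and relations of vectors back to free and plus-one generated arrangements -/

theorem CentralArrangement.isFree_of_logVectors (A : CentralArrangement K l)
    {h : Fin l → (Fin l → MvPolynomial (Fin l) K)} {a : Fin l → ℕ}
    (hhom : ∀ j i, (h j i).IsHomogeneous (a j))
    (hli : LinearIndependent (MvPolynomial (Fin l) K) h)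
    (hspan : Submodule.span (MvPolynomial (Fin l) K) (Set.range h) = A.logVectors) :
    A.IsFree := by
  have hmem : ∀ j, coefficients.symm (h j) ∈ A.logDer := fun j => by
    rw [← coefficients_mem_logVectors, LinearEquiv.apply_symm_apply, ← hspan]
    exact Submodule.subset_span ⟨j, rfl⟩
  let g : Fin l → A.logDer := fun j => ⟨coefficients.symm (h j), hmem j⟩
  have hg : LinearIndependent (MvPolynomial (Fin l) K) g := by
    refine LinearIndependent.of_comp (coefficients.toLinearMap ∘ₗ A.logDer.subtype) ?_
    convert hli
    ext1 j
    simp [g]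
  have hgspan : ⊤ ≤ Submodule.span (MvPolynomial (Fin l) K) (Set.range g) := by
    intro δ _
    have hδ := coefficients_mem_logVectors.mpr δ.2
    rw [← hspan] at hδ
    obtain ⟨v, hv⟩ := (Submodule.mem_span_range_iff_exists_fun _).mp hδ
    exact (Submodule.mem_span_range_iff_exists_fun _).mpr
      ⟨v, Subtype.ext (coefficients.injective (by simpa [g] using hv))⟩
  refine ⟨a, Module.Basis.mk hg hgspan, fun j i => ?_⟩
  rw [Module.Basis.mk_apply, ← coefficients_apply, LinearEquiv.apply_symm_apply]
  exact hhom j i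

theorem CentralArrangement.isPlusOneGenerated_of_logVectors (A : CentralArrangement K l)
    {h : Fin (l + 1) → (Fin l → MvPolynomial (Fin l) K)} {a : Fin (l + 1) → ℕ}
    {r : Fin (l + 1) → MvPolynomial (Fin l) K}
    (hhom : ∀ j i, (h j i).IsHomogeneous (a j))
    (hspan : Submodule.span (MvPolynomial (Fin l) K) (Set.range h) = A.logVectors)
    (hrel : ∀ v : Fin (l + 1) → MvPolynomial (Fin l) K,
      ∑ j, v j • h j = 0 ↔ ∃ c : MvPolynomial (Fin l) K, v = c • r)
    (hr : IsTwistedHomogeneous a (a 0 + 1) r) (hr0 : r 0 ≠ 0)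
    (hmin : ∀ j, r j ∈ idealOfVars (Fin l) K) : A.IsPlusOneGenerated := by
  have hmem : ∀ j, coefficients.symm (h j) ∈ A.logDer := fun j => by
    rw [← coefficients_mem_logVectors, LinearEquiv.apply_symm_apply, ← hspan]
    exact Submodule.subset_span ⟨j, rfl⟩
  let g : Fin (l + 1) → A.logDer := fun j => ⟨coefficients.symm (h j), hmem j⟩
  have hg : ∀ v : Fin (l + 1) → MvPolynomial (Fin l) K,
      coefficients ((Fintype.linearCombination (MvPolynomial (Fin l) K) g v : A.logDer) :
        VectorField K l) = ∑ j, v j • h j := fun v => by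
    simp [Fintype.linearCombination_apply, g]
  refine ⟨Fin.tail a, a 0, r 0, Fin.tail r, g, ?_⟩
  simp only [Fin.cons_self_tail]
  refine ⟨hr0, fun m hm => ?_, hr, fun j i => ?_, ?_, ?_, fun δ => ?_, hmin⟩
  · have := hr 0 m hm
    change Finsupp.weight (fun _ => 1) m = 1
    rw [← Finsupp.degree_eq_weight_one]
    omega
  · rw [← coefficients_apply, LinearEquiv.apply_symm_apply]
    exact hhom j i
  · intro c c' hcc
    have := congrFun hcc 0
    simpa [hr0] using this
  · intro v
    have : Fintype.linearCombination (MvPolynomial (Fin l) K) g v = 0 ↔ ∑ j, v j • h j = 0 := by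
      rw [← hg v, LinearEquiv.map_eq_zero_iff, Submodule.coe_eq_zero]
    rw [this, hrel]
    simp [eq_comm]
  · have hδ := coefficients_mem_logVectors.mpr δ.2
    rw [← hspan] at hδ
    obtain ⟨v, hv⟩ := (Submodule.mem_span_range_iff_exists_fun _).mp hδ
    exact ⟨v, Subtype.ext (coefficients.injective ((hg v).trans hv))⟩

/-! ### Localization at a flat -/

/-- A point `p` of the flat `X` off the hyperplanes of `A` outside of `A_X` gives generators of
`D(A_X)` modulo `𝔪 D(A_X)` by translating generators of `D(A)`. -/
theorem CentralArrangement.exists_sub_sum_translate_mem {A B : CentralArrangement K l}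
    {p : Fin l → K} (hB : ∀ H ∈ B.hyperplanes, p ∈ H)
    (hAB : ∀ H ∈ A.hyperplanes, H ∈ B.hyperplanes ∨ p ∉ H)
    {ι : Type*} [Fintype ι] {g : ι → (Fin l → MvPolynomial (Fin l) K)}
    (hg : Submodule.span (MvPolynomial (Fin l) K) (Set.range g) = A.logVectors)
    (hgB : ∀ j, (fun i => translateHom p (g j i)) ∈ B.logVectors)
    {y : Fin l → MvPolynomial (Fin l) K} (hy : y ∈ B.logVectors) :
    ∃ c : ι → K, y - ∑ j, c j • (fun i => translateHom p (g j i)) ∈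
      idealOfVars (Fin l) K • B.logVectors := by
  classical
  obtain ⟨Q, -, hdvd, hev⟩ := exists_defining_polynomial (A.hyperplanes.filter (p ∉ ·))
    fun H hH => A.isHyperplane H (Finset.mem_filter.mp hH).1
  have hQp : eval p Q ≠ 0 := hev p fun H hH => (Finset.mem_filter.mp hH).2
  let y' : Fin l → MvPolynomial (Fin l) K := fun i => translateHom (-p) (y i)
  have hy' : y' ∈ B.logVectors :=
    B.translate_mem_logVectors (fun H hH => neg_mem (hB H hH)) hy
  -- The factor `Q` supplies the divisibility for the hyperplanes missing `p`; the others belong to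
  -- `B`, where `y'` is logarithmic.
  have hQy : Q • y' ∈ A.logVectors := by
    rw [mem_logVectors] at hy' ⊢
    intro H hH φ hφ
    simp only [Pi.smul_apply, smul_eq_mul, mul_left_comm _ Q, ← Finset.mul_sum]
    rcases hAB H hH with hHB | hp
    · exact (hy' H hHB φ hφ).mul_left _
    · exact (hdvd H (Finset.mem_filter.mpr ⟨hH, hp⟩) φ hφ).mul_right _
  rw [← hg] at hQy
  obtain ⟨c, hc⟩ := (Submodule.mem_span_range_iff_exists_fun _).mp hQy
  have hc' : ∑ j, translateHom p (c j) • (fun i => translateHom p (g j i)) =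
      translateHom p Q • y := by
    ext1 i
    have := congrArg (translateHom p) (congrFun hc i)
    simpa [y', translate_translate_neg] using this
  -- Modulo `𝔪 D(B)`, the translated expansion of `Q • y'` reads `Q(p) y = ∑ j, c_j(p) g_j(· + p)`;
  -- dividing by `Q(p)` gives the coefficients.
  refine ⟨fun j => (eval p Q)⁻¹ * constantCoeff (translateHom p (c j)), ?_⟩
  have h1 := sum_smul_sub_constantCoeff_smul_mem hgB fun j => translateHom p (c j)
  have h2 := sum_smul_sub_constantCoeff_smul_mem (fun _ : Unit => hy) fun _ => translateHom p Q
  simp only [Finset.univ_unique, Finset.sum_singleton, constantCoeff_translate] at h2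
  have h3 := Submodule.smul_mem _ (C (eval p Q)⁻¹) (sub_mem h1 h2)
  rw [hc', sub_sub_sub_cancel_left, ← algebraMap_eq, algebraMap_smul, smul_sub,
    inv_smul_smul₀ hQp, Finset.smul_sum] at h3
  simpa only [mul_smul] using h3

theorem CentralArrangement.logVectors_mono {A B : CentralArrangement K l}
    (h : B.hyperplanes ⊆ A.hyperplanes) : A.logVectors ≤ B.logVectors := by
  intro x hx
  rw [mem_logVectors] at hx ⊢
  exact fun H hH => hx H (h hH)

/-- Multiplying by all defining forms makes any vector field logarithmic; this is why `D(A)` has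
rank `l`. -/
theorem CentralArrangement.exists_smul_mem_logVectors (A : CentralArrangement K l) :
    ∃ Q : MvPolynomial (Fin l) K, Q ≠ 0 ∧ ∀ x, Q • x ∈ A.logVectors := by
  obtain ⟨Q, hQ, hdvd, -⟩ := exists_defining_polynomial A.hyperplanes A.isHyperplane
  refine ⟨Q, hQ, fun x => mem_logVectors.mpr fun H hH φ hφ => ?_⟩
  simp only [Pi.smul_apply, smul_eq_mul, mul_left_comm _ Q, ← Finset.mul_sum]
  exact (hdvd H hH φ hφ).mul_right _

/-- Over an infinite field, the localizations of a plus-one generated arrangement are free or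
plus-one generated. -/
theorem CentralArrangement.IsPlusOneGenerated.localization [Infinite K]
    {A : CentralArrangement K l} (hA : A.IsPlusOneGenerated) (X : Submodule K (Fin l → K)) :
    (A.localization X).IsFree ∨ (A.localization X).IsPlusOneGenerated := by
  classical
  obtain ⟨exps, d, α, f, g, hα, hα1, -, -, -, hexact, hsurj, -⟩ := hA
  obtain ⟨p, hpX, hp⟩ := exists_mem_forall_notMem X (A.hyperplanes.filter (¬ X ≤ ·))
    fun H hH => (Finset.mem_filter.mp hH).2
  have hloc : ∀ H, H ∈ (A.localization X).hyperplanes ↔ H ∈ A.hyperplanes ∧ X ≤ H := fun H => by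
    simp [CentralArrangement.localization]
  have hB : ∀ H ∈ (A.localization X).hyperplanes, p ∈ H := fun H hH => ((hloc H).mp hH).2 hpX
  have hAB : ∀ H ∈ A.hyperplanes, H ∈ (A.localization X).hyperplanes ∨ p ∉ H := fun H hH => by
    rw [hloc]
    by_cases hXH : X ≤ H
    · exact .inl ⟨hH, hXH⟩
    · exact .inr (hp H (Finset.mem_filter.mpr ⟨hH, hXH⟩))
  let x : Fin (l + 1) → (Fin l → MvPolynomial (Fin l) K) := fun j => coefficients (g j).1
  have hx : Submodule.span (MvPolynomial (Fin l) K) (Set.range x) = A.logVectors := by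
    apply le_antisymm
    · rw [Submodule.span_le]
      rintro _ ⟨j, rfl⟩
      exact CentralArrangement.coefficients_mem_logVectors.mpr (g j).2
    · rintro _ ⟨δ, hδ, rfl⟩
      obtain ⟨v, hv⟩ := hsurj ⟨δ, hδ⟩
      refine (Submodule.mem_span_range_iff_exists_fun _).mpr ⟨v, ?_⟩
      have := congrArg (fun δ : A.logDer => coefficients δ.1) hv
      simpa [Fintype.linearCombination_apply, x] using this
  have hxB : ∀ j, (fun i => translateHom p (x j i)) ∈ (A.localization X).logVectors := fun j =>
    (A.localization X).translate_mem_logVectors hB <|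
      CentralArrangement.logVectors_mono (fun H hH => ((hloc H).mp hH).1)
        (hx ▸ Submodule.subset_span ⟨j, rfl⟩)
  let e : Fin (l + 1) → MvPolynomial (Fin l) K := Fin.cons α f
  have he : ∑ j, e j • x j = 0 := by
    have h1 := (hexact e).mpr ⟨1, by simp [e]⟩
    have := congrArg (fun δ : A.logDer => coefficients δ.1) h1
    simpa [Fintype.linearCombination_apply, x] using this
  have heτ : ∑ j, translateHom p (e j) • (fun i => translateHom p (x j i)) = 0 := by
    ext1 i
    have := congrArg (translateHom p) (congrFun he i)
    simpa using this
  obtain ⟨Q, hQ, hQB⟩ := (A.localization X).exists_smul_mem_logVectors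
  obtain ⟨i₀, hi₀⟩ := exists_constantCoeff_pderiv_translate_ne_zero hα hα1 p
  rcases basis_or_linear_relation
    (fun y hy k => (A.localization X).vectorComponent_mem_logVectors hy k) hQ hQB _ hxB
    (fun y hy => CentralArrangement.exists_sub_sum_translate_mem hB hAB hx hxB hy)
    (fun j => translateHom p (e j)) heτ 0 i₀ hi₀ with
    ⟨h, a, hhom, hli, hspan⟩ | ⟨h, a, r, j, hhom, hspan, hrel, hr, hrj, hmin⟩
  · exact .inl ((A.localization X).isFree_of_logVectors hhom hli hspan)
  · right
    -- The linear entry may sit at any index `j`, whereas the resolution wants it at `0`.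
    let σ := Equiv.swap 0 j
    refine (A.localization X).isPlusOneGenerated_of_logVectors (h := h ∘ σ) (a := a ∘ σ)
      (r := r ∘ σ) (fun k => hhom (σ k)) ?_ (fun v => ?_) ?_ ?_ fun k => hmin (σ k)
    · rw [σ.surjective.range_comp, hspan]
    · have h1 : ∑ k, v k • (h ∘ σ) k = ∑ k, (v ∘ σ.symm) k • h k :=
        Fintype.sum_equiv σ _ _ fun k => by simp
      rw [h1, hrel]
      refine exists_congr fun c => ⟨fun h2 => ?_, fun h2 => ?_⟩
      · ext1 k
        simpa using congrFun h2 (σ k)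
      · ext1 k
        simpa using congrFun h2 (σ.symm k)
    · intro k
      simpa [σ] using hr (σ k)
    · simpa [σ] using hrj

end Arrangement

end HypArr

theorem theorem5p5 {K : Type*} [Field K] [CharZero K] {l : ℕ}
    (A : HypArr.CentralArrangement K l) (hA : A.IsPlusOneGenerated)
    (X : Submodule K (Fin l → K)) (hX : X ∈ A.intersectionLattice) :
    (A.localization X).IsFree ∨ (A.localization X).IsPlusOneGenerated := by
  -- Characteristic zero enters only here: an infinite field lets `X` avoid the finitely many
  -- hyperplanes that do not contain it.
  have : Infinite K := Infinite.of_injective _ (Nat.cast_injective (R := K))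
  exact hA.localization X
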